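/- All Banach spaces are real. Let $X$ be a Banach space. A sequence $(x_n)$ in $X$ is *good* if for all $k\in\mathbb N$ and $a_1,\dots,a_k\in\mathbb R$ the limit of $\|a_1x_{n_1}+\dots+a_kx_{n_k}\|$ along $n_1<\dots<n_k$, $n_1\to\infty$, exists. If $(x_n)$ is good and not norm convergent, then this limit defines a norm $\|(a_1,\dots,a_k)\|$ on the space $c_{00}$ of finitely supported real sequences, and the completion of $c_{00}$ for this norm is called the *spreading model* of $X$ built on $(x_n)$. A Banach space $Z$ has the *fixed point property for affine isometries* if, for every nonempty closed convex bounded set $C\subset Z$, every affine isometry (not necessarily onto) $T:C\to C$ has a fixed point. $X$ has the *Banach–Saks property* if every bounded sequence $(x_n)$ in $X$ has a subsequence $(x_{\varphi(n)})$ such that the means $\frac1n\sum_{k=1}^n x_{\varphi(k)}$ converge in norm. **Theorem.** Suppose that every spreading model of $X$ (built on any good non-convergent sequence in $X$) has the fixed point property for affine isometries. Then $X$ has the Banach–Saks property, and in particular $X$ is reflexive. -/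

import Mathlib

open Filter Topology

/-- A sequence `x` is *good* if for all `k` and all real `a₁, …, a_k` the limit of
`‖a₁ x_{n₁} + ⋯ + a_k x_{n_k}‖` along `n₁ < ⋯ < n_k`, `n₁ → ∞`, exists. -/
def IsGood {X : Type*} [NormedAddCommGroup X] [NormedSpace ℝ X] (x : ℕ → X) : Prop :=
  ∀ (k : ℕ) (a : Fin k → ℝ), ∃ L : ℝ, ∀ ε : ℝ, 0 < ε → ∃ N : ℕ, ∀ n : Fin k → ℕ,
    StrictMono n → (∀ i, N ≤ n i) → |‖∑ i, a i • x (n i)‖ - L| < ε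

/-- The filter "`n₀ → ∞`" on the strictly increasing sequences `n₀ < n₁ < ⋯` of natural
numbers. -/
def spreadFilter : Filter (ℕ ↪o ℕ) := comap (fun n : ℕ ↪o ℕ => n 0) atTop

/-- The limit of `‖∑ i, a i • x (n i)‖` along `n₀ < n₁ < ⋯`, `n₀ → ∞`, for a finitely supported
sequence `a`. It exists when `x` is good, see `tendsto_spreadNorm`. -/
noncomputable def spreadNorm {X : Type*} [NormedAddCommGroup X] [NormedSpace ℝ X]
    (x : ℕ → X) (a : ℕ →₀ ℝ) : ℝ :=
  limUnder spreadFilter (fun n : ℕ ↪o ℕ => ‖a.sum fun i c => c • x (n i)‖)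

theorem spreadFilter_neBot : spreadFilter.NeBot := by
  refine comap_neBot fun t ht => ?_
  obtain ⟨N, hN⟩ := mem_atTop_sets.1 ht
  exact ⟨OrderEmbedding.ofStrictMono (fun i => i + N) (fun _ _ h => Nat.add_lt_add_right h N),
    hN _ (Nat.le_add_left N 0)⟩

theorem tendsto_spreadNorm {X : Type*} [NormedAddCommGroup X] [NormedSpace ℝ X] {x : ℕ → X}
    (hx : IsGood x) (a : ℕ →₀ ℝ) :
    Tendsto (fun n : ℕ ↪o ℕ => ‖a.sum fun i c => c • x (n i)‖) spreadFilter
      (𝓝 (spreadNorm x a)) := by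
  have := spreadFilter_neBot
  refine tendsto_nhds_limUnder ?_
  obtain ⟨k, hk⟩ : ∃ k, a.support ⊆ Finset.range k := a.support.exists_nat_subset_range
  obtain ⟨L, hL⟩ := hx k (fun i => a i)
  refine ⟨L, Metric.tendsto_nhds.2 fun ε hε => ?_⟩
  obtain ⟨N, hN⟩ := hL ε hε
  refine mem_comap.2 ⟨_, Ici_mem_atTop N, fun n hn => ?_⟩
  have h := hN (fun i : Fin k => n i) (fun i j hij => n.strictMono hij)
    (fun i => le_trans (Set.mem_Ici.1 hn) (n.monotone (Nat.zero_le _)))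
  have hs : (a.sum fun i c => c • x (n i)) = ∑ i : Fin k, a i • x (n i) := by
    rw [Finsupp.sum_of_support_subset a hk _ (by simp),
      Finset.sum_range (fun i => a i • x (n i))]
  simpa [Real.dist_eq, hs] using h

theorem spreadNorm_nonneg {X : Type*} [NormedAddCommGroup X] [NormedSpace ℝ X] {x : ℕ → X}
    (hx : IsGood x) (a : ℕ →₀ ℝ) : 0 ≤ spreadNorm x a := by
  have := spreadFilter_neBot
  exact ge_of_tendsto' (tendsto_spreadNorm hx a) fun _ => norm_nonneg _

theorem spreadNorm_smul {X : Type*} [NormedAddCommGroup X] [NormedSpace ℝ X] {x : ℕ → X}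
    (hx : IsGood x) (c : ℝ) (a : ℕ →₀ ℝ) : spreadNorm x (c • a) = ‖c‖ * spreadNorm x a := by
  have := spreadFilter_neBot
  refine tendsto_nhds_unique (tendsto_spreadNorm hx (c • a))
    (((tendsto_spreadNorm hx a).const_mul ‖c‖).congr fun n => ?_)
  rw [← norm_smul, Finsupp.sum_smul_index (by simp), Finsupp.smul_sum]
  simp only [mul_smul]

theorem spreadNorm_add_le {X : Type*} [NormedAddCommGroup X] [NormedSpace ℝ X] {x : ℕ → X}
    (hx : IsGood x) (a b : ℕ →₀ ℝ) :
    spreadNorm x (a + b) ≤ spreadNorm x a + spreadNorm x b := by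
  have := spreadFilter_neBot
  refine le_of_tendsto_of_tendsto' (tendsto_spreadNorm hx (a + b))
    ((tendsto_spreadNorm hx a).add (tendsto_spreadNorm hx b)) fun n => ?_
  rw [Finsupp.sum_add_index' (by simp) (by intros; rw [add_smul])]
  exact norm_add_le _ _

/-- The space `c₀₀` of finitely supported real sequences, to be endowed with the seminorm
`spreadNorm x` of a good sequence `x`. -/
def SpreadingPre {X : Type*} [NormedAddCommGroup X] [NormedSpace ℝ X]
    (x : ℕ → X) (_hx : IsGood x) : Type :=
  ℕ →₀ ℝ

noncomputable instance instAddCommGroupSpreadingPre {X : Type*} [NormedAddCommGroup X] [NormedSpace ℝ X]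
    (x : ℕ → X) (hx : IsGood x) : AddCommGroup (SpreadingPre x hx) :=
  inferInstanceAs (AddCommGroup (ℕ →₀ ℝ))

noncomputable instance instModuleSpreadingPre {X : Type*} [NormedAddCommGroup X] [NormedSpace ℝ X]
    (x : ℕ → X) (hx : IsGood x) : Module ℝ (SpreadingPre x hx) :=
  inferInstanceAs (Module ℝ (ℕ →₀ ℝ))

noncomputable instance instNormSpreadingPre {X : Type*} [NormedAddCommGroup X] [NormedSpace ℝ X]
    (x : ℕ → X) (hx : IsGood x) : Norm (SpreadingPre x hx) :=
  ⟨fun a => spreadNorm x a⟩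

noncomputable instance instSeminormedAddCommGroupSpreadingPre {X : Type*}
    [NormedAddCommGroup X] [NormedSpace ℝ X] (x : ℕ → X) (hx : IsGood x) :
    SeminormedAddCommGroup (SpreadingPre x hx) :=
  SeminormedAddCommGroup.ofCore (𝕜 := ℝ)
    { norm_nonneg := spreadNorm_nonneg hx
      norm_smul := spreadNorm_smul hx
      norm_triangle := spreadNorm_add_le hx }

noncomputable instance instNormedSpaceSpreadingPre {X : Type*}
    [NormedAddCommGroup X] [NormedSpace ℝ X] (x : ℕ → X) (hx : IsGood x) :
    NormedSpace ℝ (SpreadingPre x hx) where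
  norm_smul_le c a := (spreadNorm_smul hx c a).le

/-- The Banach space obtained by completing `c₀₀` for `spreadNorm x`. When the good sequence `x`
does not converge this is the *spreading model* built on `x`. -/
abbrev SpreadingModel {X : Type*} [NormedAddCommGroup X] [NormedSpace ℝ X]
    (x : ℕ → X) (hx : IsGood x) : Type :=
  UniformSpace.Completion (SpreadingPre x hx)

/-- The fixed point property for affine isometries: every affine isometry (not necessarily onto)
of a nonempty closed convex bounded subset `C` into itself has a fixed point. -/
def FPPAffineIsometries (Z : Type*) [NormedAddCommGroup Z] [NormedSpace ℝ Z] : Prop :=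
  ∀ C : Set Z, C.Nonempty → IsClosed C → Convex ℝ C → Bornology.IsBounded C →
    ∀ T : Z → Z, Set.MapsTo T C C →
      (∀ u ∈ C, ∀ v ∈ C, dist (T u) (T v) = dist u v) →
      (∀ u ∈ C, ∀ v ∈ C, ∀ s t : ℝ, 0 ≤ s → 0 ≤ t → s + t = 1 →
        T (s • u + t • v) = s • T u + t • T v) →
      ∃ z ∈ C, T z = z

/-- The Banach–Saks property: every bounded sequence has a subsequence whose arithmetic means
converge in norm. -/
def BanachSaksProperty (X : Type*) [NormedAddCommGroup X] [NormedSpace ℝ X] : Prop :=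
  ∀ x : ℕ → X, Bornology.IsBounded (Set.range x) →
    ∃ φ : ℕ → ℕ, StrictMono φ ∧ ∃ l : X,
      Tendsto (fun n : ℕ => (n : ℝ)⁻¹ • ∑ k ∈ Finset.range n, x (φ k)) atTop (𝓝 l)

/-- Reflexivity: the canonical embedding into the bidual is onto. -/
def IsReflexiveSpace (X : Type*) [NormedAddCommGroup X] [NormedSpace ℝ X] : Prop :=
  Function.Surjective (NormedSpace.inclusionInDoubleDual ℝ X)

/-! A bounded sequence has a good subsequence `x` (`exists_strictMono_isGood`). If `x` converges, so
do its means. Otherwise the shift of its spreading model is a linear isometry that preserves the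
closed convex hull of the basis, which is bounded, so it has a fixed point there. A finite convex
combination `a` near the fixed point is then almost invariant under all powers of the shift at once.

A power that moves `a` past its own support turns this into a statement about `x`: the averages `w j
= ∑ a i • x (j + i)` are nearly constant for `j ≥ N` (`exists_forall_norm_sum_sub_lt`). The Cesàro
means of `w` and of `x` differ asymptotically by nothing, so the means of `x` are eventually near `w
N`, hence Cauchy.

Reflexivity follows from the Banach–Saks property alone: a non-reflexive space contains a bounded
sequence with a James system of functionals, and these keep the means of every subsequence from
being Cauchy. -/

/-! ### Good subsequences from iterated ultrafilter limits. -/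

/-- The iterated limit along the ultrafilter `hyperfilter ℕ` of `‖v + ∑ i, a i • x (n i)‖`, the
last index running first. -/
noncomputable def iterLim {X : Type*} [NormedAddCommGroup X] [NormedSpace ℝ X] (x : ℕ → X) :
    ∀ k : ℕ, (Fin k → ℝ) → X → ℝ
  | 0, _, v => ‖v‖
  | k + 1, a, v => limUnder (hyperfilter ℕ : Filter ℕ)
      fun n => iterLim x k (Fin.tail a) (v + a 0 • x n)

theorem Ultrafilter.tendsto_limUnder_of_bounded (U : Ultrafilter ℕ) {f : ℕ → ℝ} {A : ℝ}
    (hf : ∀ n, |f n| ≤ A) : Tendsto f U (𝓝 (limUnder (U : Filter ℕ) f)) := by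
  refine tendsto_nhds_limUnder ?_
  obtain ⟨l, -, hl⟩ := (isCompact_closedBall (0 : ℝ) A).ultrafilter_le_nhds (U.map f)
    (le_principal_iff.2 (Ultrafilter.mem_map.2 (Filter.univ_mem' fun n => by simpa using hf n)))
  exact ⟨l, hl⟩

section

variable {X : Type*} [NormedAddCommGroup X] [NormedSpace ℝ X] {x : ℕ → X} {B : ℝ}

theorem abs_iterLim_le (hx : ∀ n, ‖x n‖ ≤ B) (k : ℕ) (a : Fin k → ℝ) (v : X) :
    |iterLim x k a v| ≤ ‖v‖ + (∑ i, |a i|) * B := by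
  induction k generalizing v with
  | zero => simp [iterLim]
  | succ k ih =>
    have hle : ∀ n, |iterLim x k (Fin.tail a) (v + a 0 • x n)| ≤ ‖v‖ + (∑ i, |a i|) * B := by
      intro n
      refine (ih _ _).trans ?_
      have h1 : ‖v + a 0 • x n‖ ≤ ‖v‖ + |a 0| * B :=
        (norm_add_le _ _).trans (by
          rw [norm_smul, Real.norm_eq_abs]
          gcongr
          exact hx n)
      rw [Fin.sum_univ_succ]
      simp only [Fin.tail]
      linarith
    exact le_of_tendsto' ((hyperfilter ℕ).tendsto_limUnder_of_bounded hle).abs hle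

theorem tendsto_iterLim (hx : ∀ n, ‖x n‖ ≤ B) (k : ℕ) (a : Fin (k + 1) → ℝ) (v : X) :
    Tendsto (fun n => iterLim x k (Fin.tail a) (v + a 0 • x n)) (hyperfilter ℕ)
      (𝓝 (iterLim x (k + 1) a v)) := by
  refine (hyperfilter ℕ).tendsto_limUnder_of_bounded
    (A := ‖v‖ + |a 0| * B + (∑ i, |Fin.tail a i|) * B) fun n => ?_
  refine (abs_iterLim_le hx _ _ _).trans (add_le_add_left ((norm_add_le _ _).trans ?_) _)
  rw [norm_smul, Real.norm_eq_abs]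
  gcongr
  exact hx n

theorem norm_add_smul_sub_le (hx : ∀ n, ‖x n‖ ≤ B) (v w : X) (s t : ℝ) (n : ℕ) :
    ‖(v + s • x n) - (w + t • x n)‖ ≤ ‖v - w‖ + |s - t| * B := by
  rw [show (v + s • x n) - (w + t • x n) = (v - w) + (s - t) • x n by rw [sub_smul]; abel]
  refine (norm_add_le _ _).trans ?_
  rw [norm_smul, Real.norm_eq_abs]
  gcongr
  exact hx n

/-- Norms are 1-Lipschitz and this survives each limit. Such joint control in coefficients and
vector reduces uniformity on compact sets to a finite net. -/
theorem abs_iterLim_sub_le (hx : ∀ n, ‖x n‖ ≤ B) (k : ℕ) (a b : Fin k → ℝ) (v w : X) :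
    |iterLim x k a v - iterLim x k b w| ≤ ‖v - w‖ + (∑ i, |a i - b i|) * B := by
  induction k generalizing v w with
  | zero => simpa [iterLim] using abs_norm_sub_norm_le v w
  | succ k ih =>
    refine le_of_tendsto' ((tendsto_iterLim hx k a v).sub (tendsto_iterLim hx k b w)).abs
      fun n => (ih _ _ _ _).trans ?_
    have := norm_add_smul_sub_le hx v w (a 0) (b 0) n
    rw [Fin.sum_univ_succ]
    simp only [Fin.tail]
    linarith

/-- The limits defining `iterLim` are uniform on compact sets. -/
theorem eventually_abs_iterLim_sub_lt (hx : ∀ n, ‖x n‖ ≤ B) (k : ℕ) {K : Set X}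
    (hK : IsCompact K) (M : ℝ) {ε : ℝ} (hε : 0 < ε) :
    ∀ᶠ n in (hyperfilter ℕ : Filter ℕ), ∀ v ∈ K, ∀ a : Fin (k + 1) → ℝ, (∀ i, |a i| ≤ M) →
      |iterLim x k (Fin.tail a) (v + a 0 • x n) - iterLim x (k + 1) a v| < ε := by
  have hB : 0 ≤ B := (norm_nonneg _).trans (hx 0)
  -- Moving to a net point at distance `ε / (3 * C)` costs at most that distance times `1 + (k + 1)
  -- * B`, that is `ε / 3`.
  set C : ℝ := 1 + (k + 1) * B with hC
  have hC0 : 0 < C := by positivity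
  have hc : IsCompact (K ×ˢ Metric.closedBall (0 : Fin (k + 1) → ℝ) M) :=
    hK.prod (isCompact_closedBall _ _)
  obtain ⟨t, -, htf, ht⟩ := hc.finite_cover_balls (e := ε / (3 * C)) (by positivity)
  have hev : ∀ᶠ n in (hyperfilter ℕ : Filter ℕ), ∀ p ∈ t,
      |iterLim x k (Fin.tail p.2) (p.1 + p.2 0 • x n) - iterLim x (k + 1) p.2 p.1| < ε / 3 := by
    refine (eventually_all_finite htf).2 fun p _ => ?_
    simpa [Real.dist_eq] using
      Metric.tendsto_nhds.1 (tendsto_iterLim hx k p.2 p.1) (ε / 3) (by positivity)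
  filter_upwards [hev] with n hn v hv a ha
  obtain ⟨p, hp, hd⟩ := Set.mem_iUnion₂.1 (ht (show (v, a) ∈ _ from ⟨hv, by
    rw [mem_closedBall_zero_iff]
    exact (pi_norm_le_iff_of_nonneg ((abs_nonneg _).trans (ha 0))).2 ha⟩))
  rw [Metric.mem_ball, Prod.dist_eq, max_lt_iff, dist_eq_norm, dist_eq_norm] at hd
  have hsum : ∑ i, |a i - p.2 i| ≤ (k + 1) * (ε / (3 * C)) := by
    have := Finset.sum_le_card_nsmul Finset.univ (fun i => |a i - p.2 i|) (ε / (3 * C))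
      fun i _ => (norm_le_pi_norm (a - p.2) i).trans hd.2.le
    simpa using this
  have hb : ‖v - p.1‖ + (∑ i, |a i - p.2 i|) * B < ε / 3 := by
    have h1 : (∑ i, |a i - p.2 i|) * B ≤ (k + 1) * (ε / (3 * C)) * B := by gcongr
    have h2 : ε / (3 * C) + (k + 1) * (ε / (3 * C)) * B = ε / 3 := by
      field_simp
      rw [hC]
    have h3 := hd.1
    dsimp only at h3
    linarith
  have h1 : |iterLim x (k + 1) a v - iterLim x (k + 1) p.2 p.1| < ε / 3 :=
    (abs_iterLim_sub_le hx _ _ _ _ _).trans_lt hb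
  have h2 : |iterLim x k (Fin.tail a) (v + a 0 • x n) -
      iterLim x k (Fin.tail p.2) (p.1 + p.2 0 • x n)| < ε / 3 := by
    refine (abs_iterLim_sub_le hx _ _ _ _ _).trans_lt (lt_of_le_of_lt ?_ hb)
    have := norm_add_smul_sub_le hx v p.1 (a 0) (p.2 0) n
    rw [Fin.sum_univ_succ]
    simp only [Fin.tail]
    linarith
  have h3 := hn p hp
  rw [abs_lt] at h1 h2 h3 ⊢
  constructor <;> linarith

/-- The linear combinations of `x 0, …, x (b - 1)` with coefficients bounded by `M`. -/
def boundedCombinations (x : ℕ → X) (M : ℝ) : ℕ → Set X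
  | 0 => {0}
  | b + 1 => (fun p : X × ℝ => p.1 + p.2 • x b) '' (boundedCombinations x M b ×ˢ Set.Icc (-M) M)

theorem isCompact_boundedCombinations (x : ℕ → X) (M : ℝ) (b : ℕ) :
    IsCompact (boundedCombinations x M b) := by
  induction b with
  | zero => exact isCompact_singleton
  | succ b ih => exact (ih.prod isCompact_Icc).image (by fun_prop)

theorem add_smul_mem_boundedCombinations {M : ℝ} {b : ℕ} {v : X}
    (hv : v ∈ boundedCombinations x M b) {t : ℝ} (ht : |t| ≤ M) :
    v + t • x b ∈ boundedCombinations x M (b + 1) :=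
  ⟨(v, t), ⟨hv, abs_le.1 ht⟩, rfl⟩

theorem monotone_boundedCombinations {M : ℝ} (hM : 0 ≤ M) :
    Monotone (boundedCombinations x M) :=
  monotone_nat_of_le_succ fun b v hv => by
    simpa using add_smul_mem_boundedCombinations hv (t := 0) (by simpa using hM)

theorem boundedCombinations_mono {M M' : ℝ} (h : M ≤ M') (b : ℕ) :
    boundedCombinations x M b ⊆ boundedCombinations x M' b := by
  induction b with
  | zero => exact subset_rfl
  | succ b ih =>
    exact Set.image_mono (Set.prod_mono ih (Set.Icc_subset_Icc (neg_le_neg h) h))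

/-- Every bounded sequence has a good subsequence (Brunel–Sucheston). -/
theorem exists_strictMono_isGood (hx : ∀ n, ‖x n‖ ≤ B) :
    ∃ φ : ℕ → ℕ, StrictMono φ ∧ IsGood (x ∘ φ) := by
  -- Diagonal choice: the single parameter `b` bounds the depth of the limits, the coefficients and
  -- the indices already used, and fixes the error.
  have hstep : ∀ b : ℕ, ∃ n, b < n ∧ ∀ k < b, ∀ v ∈ boundedCombinations x b (b + 1),
      ∀ a : Fin (k + 1) → ℝ, (∀ i, |a i| ≤ b) →
        |iterLim x k (Fin.tail a) (v + a 0 • x n) - iterLim x (k + 1) a v| < 1 / ((b : ℝ) + 1) := by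
    intro b
    have h1 : ∀ᶠ n in (hyperfilter ℕ : Filter ℕ), b < n :=
      Nat.hyperfilter_le_atTop (eventually_gt_atTop b)
    have h2 := (eventually_all_finite (Set.finite_lt_nat b)).2 fun k (_ : k ∈ {k | k < b}) =>
      eventually_abs_iterLim_sub_lt hx k (isCompact_boundedCombinations x b (b + 1)) b
        (show (0 : ℝ) < 1 / ((b : ℝ) + 1) by positivity)
    exact (h1.and h2).exists
  choose g hg hgQ using hstep
  set φ : ℕ → ℕ := fun m => g^[m] 0 with hφdef
  have hφs : ∀ m, φ (m + 1) = g (φ m) := fun m => Function.iterate_succ_apply' _ _ _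
  have hφ : StrictMono φ := strictMono_nat_of_lt_succ fun m => by rw [hφs]; exact hg _
  refine ⟨φ, hφ, fun k a => ⟨iterLim x k a 0, fun ε hε => ?_⟩⟩
  obtain ⟨M, hM0, hM⟩ : ∃ M : ℕ, 0 ≤ M ∧ ∀ i, |a i| ≤ M := by
    obtain ⟨M, hM⟩ := exists_nat_ge ‖a‖
    exact ⟨M, Nat.zero_le _, fun i => (norm_le_pi_norm a i).trans hM⟩
  obtain ⟨N₁, hN₁⟩ := exists_nat_gt (((k : ℝ) + 1) / ε)
  have hk1 : (0 : ℝ) < (k : ℝ) + 1 := by positivity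
  -- Replace the limits one index at a time, smallest first, each at cost `ε / (k + 1)`. With `n 0 =
  -- q + 1`, the term `x (φ (n 0))` was chosen for `b = φ q`, and `v` involves no later index.
  have main : ∀ (j : ℕ) (a : Fin j → ℝ), j ≤ k → (∀ i, |a i| ≤ M) → ∀ (m : ℕ) (n : Fin j → ℕ)
      (v : X), StrictMono n → k ≤ m → M ≤ m → N₁ ≤ m → (∀ i, m < n i) →
      v ∈ boundedCombinations x M (φ m + 1) →
      |‖v + ∑ i, a i • x (φ (n i))‖ - iterLim x j a v| ≤ j * (ε / (k + 1)) := by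
    intro j
    induction j with
    | zero => intros; simp [iterLim]
    | succ j ih =>
      intro a hjk ha m n v hn hkm hMm hNm hmn hv
      obtain ⟨q, hq⟩ : ∃ q, n 0 = q + 1 := Nat.exists_eq_succ_of_ne_zero (by have := hmn 0; omega)
      have hmq : m ≤ q := by have := hmn 0; omega
      have hqφ : q ≤ φ q := hφ.id_le q
      have hMR : (0 : ℝ) ≤ M := Nat.cast_nonneg _
      have hvq : v ∈ boundedCombinations x M (φ q + 1) :=
        monotone_boundedCombinations hMR (Nat.add_le_add_right (hφ.monotone hmq) 1) hv
      have hMφ : (M : ℝ) ≤ (φ q : ℕ) := by exact_mod_cast (hMm.trans hmq).trans hqφ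
      have h1 := hgQ (φ q) j (by omega) v (boundedCombinations_mono hMφ _ hvq) a
        fun i => (ha i).trans hMφ
      rw [← hφs, ← hq] at h1
      have h2 := ih (Fin.tail a) (by omega) (fun i => ha _) (n 0) (Fin.tail n)
        (v + a 0 • x (φ (n 0))) (fun i i' h => hn (Fin.succ_lt_succ_iff.2 h))
        (by have := hmn 0; omega) (by have := hmn 0; omega) (by have := hmn 0; omega)
        (fun i => hn (Fin.succ_pos i))
        (add_smul_mem_boundedCombinations
          (monotone_boundedCombinations hMR (by rw [hq]; exact hφ (Nat.lt_succ_self q)) hvq) (ha 0))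
      have h3 : 1 / (((φ q : ℕ) : ℝ) + 1) ≤ ε / (k + 1) := by
        have : (N₁ : ℝ) ≤ (φ q : ℕ) := by exact_mod_cast (hNm.trans hmq).trans hqφ
        rw [div_le_div_iff₀ (by positivity) hk1, one_mul]
        rw [div_lt_iff₀ hε] at hN₁
        nlinarith
      have h4 : v + ∑ i, a i • x (φ (n i)) =
          v + a 0 • x (φ (n 0)) + ∑ i, Fin.tail a i • x (φ (Fin.tail n i)) := by
        rw [Fin.sum_univ_succ, add_assoc]
        rfl
      rw [h4]
      refine (abs_sub_le _ (iterLim x j (Fin.tail a) (v + a 0 • x (φ (n 0)))) _).trans ?_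
      push_cast
      linarith
  refine ⟨max (max k M) N₁ + 1, fun n hn hN => ?_⟩
  have h0 : (0 : X) ∈ boundedCombinations x M (φ (max (max k M) N₁) + 1) :=
    monotone_boundedCombinations (Nat.cast_nonneg M) (Nat.zero_le _) rfl
  have := main k a le_rfl hM (max (max k M) N₁) n 0 hn (by omega) (by omega) (by omega)
    (fun i => hN i) h0
  rw [zero_add] at this
  refine this.trans_lt ?_
  rw [mul_div_assoc', div_lt_iff₀ hk1]
  nlinarith

end

/-! ### Banach–Saks implies reflexive, by James' sequences. -/

set_option maxSynthPendingDepth 3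

/-- Goldstine's theorem for finitely many functionals. -/
theorem exists_norm_le_forall_abs_sub_lt {E : Type*} [NormedAddCommGroup E] [NormedSpace ℝ E]
    (ξ : StrongDual ℝ (StrongDual ℝ E)) (s : Finset (StrongDual ℝ E)) {ε : ℝ} (hε : 0 < ε) :
    ∃ x : E, ‖x‖ ≤ ‖ξ‖ ∧ ∀ f ∈ s, |f x - ξ f| < ε := by
  classical
  let L : E →L[ℝ] (s → ℝ) := ContinuousLinearMap.pi fun f => f.1
  let p : s → ℝ := fun f => ξ f.1
  -- A separating `g` pulls back to a combination `F` of the given functionals with `F < u` on the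
  -- ball of radius `‖ξ‖`. Hence `‖ξ‖ * ‖F‖ ≤ u`, whereas `ξ F = g p > u`.
  have hp : p ∈ closure (L '' Metric.closedBall 0 ‖ξ‖) := by
    by_contra hp
    obtain ⟨g, u, hg, hu⟩ := geometric_hahn_banach_closed_point
      ((convex_closedBall (0 : E) ‖ξ‖).linear_image L.toLinearMap).closure isClosed_closure hp
    let F : StrongDual ℝ E := ∑ f : s, g (Pi.single f 1) • f.1
    have hsum : ∀ v : s → ℝ, g v = ∑ f : s, g (Pi.single f 1) * v f := fun v => by
      conv_lhs => rw [← Finset.univ_sum_single v, map_sum]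
      refine Finset.sum_congr rfl fun f _ => ?_
      rw [mul_comm, ← smul_eq_mul, ← map_smul, ← Pi.single_smul, smul_eq_mul, mul_one]
    have hF : ∀ x, F x = g (L x) := fun x => by
      rw [hsum (L x)]
      simp [F, L]
    have hξ : ξ F = g p := by
      simp [hsum p, F, p]
    have hlt : ∀ x, ‖x‖ ≤ ‖ξ‖ → F x < u := fun x hx => by
      rw [hF]
      exact hg _ (subset_closure ⟨x, by simpa using hx, rfl⟩)
    have hu0 : 0 < u := by simpa using hlt 0 (by simp)
    have hn : ‖‖ξ‖ • F‖ ≤ u := by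
      refine ContinuousLinearMap.opNorm_le_of_unit_norm hu0.le fun x hx => ?_
      have h1 := hlt (‖ξ‖ • x) (by simp [norm_smul, hx])
      have h2 := hlt (-(‖ξ‖ • x)) (by simp [norm_smul, hx])
      simp only [map_neg, map_smul, smul_eq_mul] at h1 h2
      simp only [smul_apply, smul_eq_mul, Real.norm_eq_abs]
      exact abs_le.2 ⟨by linarith, h1.le⟩
    have h3 : ξ F ≤ ‖ξ‖ * ‖F‖ := (le_abs_self _).trans (ξ.le_opNorm F)
    rw [norm_smul, norm_norm] at hn
    linarith
  obtain ⟨_, ⟨x, hx, rfl⟩, hd⟩ := Metric.mem_closure_iff.1 hp ε hε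
  refine ⟨x, by simpa using hx, fun f hf => ?_⟩
  have := (dist_pi_lt_iff hε).1 hd ⟨f, hf⟩
  rwa [dist_comm, Real.dist_eq] at this

/-- A functional outside of the canonical image of a Banach space in its bidual is separated from
this image. -/
theorem exists_triple_dual_annihilator {X : Type*} [NormedAddCommGroup X] [NormedSpace ℝ X]
    [CompleteSpace X] {ξ : StrongDual ℝ (StrongDual ℝ X)}
    (hξ : ξ ∉ Set.range (NormedSpace.inclusionInDoubleDual ℝ X)) :
    ∃ Φ : StrongDual ℝ (StrongDual ℝ (StrongDual ℝ X)), 0 < Φ ξ ∧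
      ∀ x, Φ (NormedSpace.inclusionInDoubleDual ℝ X x) = 0 := by
  let J := NormedSpace.inclusionInDoubleDual ℝ X
  have hcl : IsClosed (Set.range J) :=
    (NormedSpace.inclusionInDoubleDualLi (E := X) ℝ).isometry.isClosedEmbedding.isClosed_range
  have hconv : Convex ℝ (Set.range J) := by
    have := (convex_univ (𝕜 := ℝ) (E := X)).linear_image J.toLinearMap
    rwa [Set.image_univ] at this
  obtain ⟨Φ, u, hΦ, hu⟩ := geometric_hahn_banach_closed_point hconv hcl hξ
  have hlt : ∀ x, Φ (J x) < u := fun x => hΦ _ ⟨x, rfl⟩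
  have hu0 : 0 < u := by simpa using hlt 0
  refine ⟨Φ, hu0.trans hu, fun x => ?_⟩
  by_contra hx
  have := hlt ((u / Φ (J x)) • x)
  rw [map_smul, map_smul, smul_eq_mul, div_mul_cancel₀ _ hx] at this
  exact lt_irrefl _ this

/-- James' sequences in a non-reflexive Banach space. -/
theorem exists_james_sequence {X : Type*} [NormedAddCommGroup X] [NormedSpace ℝ X]
    [CompleteSpace X] (hX : ¬ IsReflexiveSpace X) :
    ∃ (x : ℕ → X) (f : ℕ → StrongDual ℝ X) (A B δ : ℝ), 0 < δ ∧ (∀ n, ‖x n‖ ≤ A) ∧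
      (∀ n, ‖f n‖ ≤ B) ∧ (∀ m n, m ≤ n → δ / 2 < f m (x n)) ∧
      (∀ m n, n < m → f m (x n) < δ / 4) := by
  classical
  obtain ⟨ξ, hξ⟩ : ∃ ξ, ξ ∉ Set.range (NormedSpace.inclusionInDoubleDual ℝ X) := by
    simpa [IsReflexiveSpace, Function.Surjective] using hX
  obtain ⟨Φ, hδ, hΦ⟩ := exists_triple_dual_annihilator hξ
  -- Goldstine twice per stage: `f` imitates `Φ` on `ξ` and on the earlier vectors, where `Φ`
  -- vanishes; then `x` imitates `ξ` on `f` and on the earlier functionals. The margin `3 * Φ ξ / 4`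
  -- leaves `Φ ξ / 2` after an error `Φ ξ / 4`.
  obtain ⟨p, hP, hr⟩ := exists_seq_of_forall_finset_exists
    (α := StrongDual ℝ X × X)
    (fun p => ‖p.1‖ ≤ ‖Φ‖ ∧ 3 * Φ ξ / 4 < ξ p.1 ∧ ‖p.2‖ ≤ ‖ξ‖ ∧ Φ ξ / 2 < p.1 p.2)
    (fun p q => q.1 p.2 < Φ ξ / 4 ∧ Φ ξ / 2 < p.1 q.2) (by
      intro s hs
      obtain ⟨f, hfn, hf⟩ := exists_norm_le_forall_abs_sub_lt Φ
        (insert ξ (s.image fun p => NormedSpace.inclusionInDoubleDual ℝ X p.2))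
        (ε := Φ ξ / 4) (by linarith)
      have hfξ := abs_lt.1 (hf ξ (Finset.mem_insert_self _ _))
      obtain ⟨x, hxn, hx⟩ := exists_norm_le_forall_abs_sub_lt ξ
        (insert f (s.image Prod.fst)) (ε := Φ ξ / 4) (by linarith)
      have hxf := abs_lt.1 (hx f (Finset.mem_insert_self _ _))
      refine ⟨(f, x), ⟨hfn, by dsimp only; linarith, hxn, by dsimp only; linarith⟩,
        fun q hq => ⟨?_, ?_⟩⟩
      · have := abs_lt.1 (hf (NormedSpace.inclusionInDoubleDual ℝ X q.2)
          (Finset.mem_insert_of_mem (Finset.mem_image_of_mem _ hq)))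
        rw [hΦ, NormedSpace.dual_def] at this
        dsimp only; linarith
      · have h1 := abs_lt.1 (hx q.1
          (Finset.mem_insert_of_mem (Finset.mem_image_of_mem _ hq)))
        have h2 := (hs q hq).2.1
        dsimp only; linarith)
  refine ⟨fun n => (p n).2, fun n => (p n).1, ‖ξ‖, ‖Φ‖, Φ ξ, hδ, fun n => (hP n).2.2.1,
    fun n => (hP n).1, fun m n hmn => ?_, fun m n hmn => (hr n m hmn).1⟩
  rcases hmn.eq_or_lt with rfl | h
  · exact (hP m).2.2.2
  · exact (hr m n h).2

/-- A Banach space with the Banach–Saks property is reflexive. -/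
theorem BanachSaksProperty.isReflexiveSpace {X : Type*} [NormedAddCommGroup X] [NormedSpace ℝ X]
    [CompleteSpace X] (h : BanachSaksProperty X) : IsReflexiveSpace X := by
  by_contra hX
  obtain ⟨x, f, A, B, δ, hδ, hA, hB, hge, hlt⟩ := exists_james_sequence hX
  obtain ⟨φ, hφ, l, hl⟩ := h x (isBounded_iff_forall_norm_le.2 ⟨A, by rintro _ ⟨n, rfl⟩; exact hA n⟩)
  set m : ℕ → X := fun n => (n : ℝ)⁻¹ • ∑ k ∈ Finset.range n, x (φ k) with hm
  -- The means of lengths `n` and `2 * n` are compared through `f (φ n)`, which is small on the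
  -- first block of `n` terms and large on the second. The gap is at least `(δ / 2 - δ / 4) / 2 = δ
  -- / 8`.
  have h2 : Tendsto (fun n : ℕ => m (2 * n)) atTop (𝓝 l) :=
    hl.comp (tendsto_id.const_mul_atTop' (by norm_num))
  have h0 : Tendsto (fun n : ℕ => B * ‖m (2 * n) - m n‖) atTop (𝓝 0) := by
    simpa using ((h2.sub hl).norm).const_mul B
  obtain ⟨n, hn, hn1⟩ := ((h0.eventually (gt_mem_nhds (show (0 : ℝ) < δ / 8 by linarith))).and
    (eventually_ge_atTop 1)).exists
  have hn0 : (0 : ℝ) < n := by exact_mod_cast hn1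
  have hfirst : ∑ k ∈ Finset.range n, f (φ n) (x (φ k)) ≤ n * (δ / 4) := by
    have := Finset.sum_le_card_nsmul (Finset.range n) (fun k => f (φ n) (x (φ k))) (δ / 4)
      fun k hk => (hlt _ _ (hφ (Finset.mem_range.1 hk))).le
    simpa using this
  have hsecond : n * (δ / 2) ≤ ∑ k ∈ Finset.range n, f (φ n) (x (φ (n + k))) := by
    have := Finset.card_nsmul_le_sum (Finset.range n) (fun k => f (φ n) (x (φ (n + k)))) (δ / 2)
      fun k _ => (hge _ _ (hφ.monotone (Nat.le_add_right n k))).le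
    simpa using this
  have heq : f (φ n) (m (2 * n) - m n) = (n : ℝ)⁻¹ * 2⁻¹ *
      (∑ k ∈ Finset.range n, f (φ n) (x (φ (n + k))) -
        ∑ k ∈ Finset.range n, f (φ n) (x (φ k))) := by
    simp only [hm, two_mul n, Finset.sum_range_add, map_sub, map_smul, map_add, map_sum,
      smul_eq_mul, Nat.cast_add]
    field_simp
    ring
  have hge' : δ / 8 ≤ f (φ n) (m (2 * n) - m n) := by
    rw [heq]
    calc δ / 8 = (n : ℝ)⁻¹ * 2⁻¹ * (n * (δ / 2) - n * (δ / 4)) := by field_simp; ring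
      _ ≤ _ := by gcongr
  have hle : f (φ n) (m (2 * n) - m n) ≤ B * ‖m (2 * n) - m n‖ :=
    (le_abs_self _).trans (((f (φ n)).le_opNorm _).trans (by gcongr; exact hB _))
  linarith

/-! ### The shift of a spreading model and its fixed points. -/

section

variable {X : Type*} [NormedAddCommGroup X] [NormedSpace ℝ X]

theorem tendsto_spreadFilter_shift :
    Tendsto (fun n : ℕ ↪o ℕ => (OrderEmbedding.ofStrictMono Nat.succ
      (fun _ _ h => Nat.succ_lt_succ h)).trans n) spreadFilter spreadFilter :=
  tendsto_comap_iff.2 (tendsto_atTop_mono (fun n => n.monotone (Nat.zero_le 1)) tendsto_comap)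

/-- The norm of a spreading model is invariant under the shift. -/
theorem spreadNorm_mapDomain_succ {x : ℕ → X} (hx : IsGood x) (a : ℕ →₀ ℝ) :
    spreadNorm x (a.mapDomain Nat.succ) = spreadNorm x a := by
  have := spreadFilter_neBot
  refine tendsto_nhds_unique (tendsto_spreadNorm hx _)
    (((tendsto_spreadNorm hx a).comp tendsto_spreadFilter_shift).congr fun n => ?_)
  rw [Finsupp.sum_mapDomain_index (by simp) (by intros; rw [add_smul])]
  rfl

/-- The shift of a spreading model, before completion. -/
noncomputable def spreadShift (x : ℕ → X) (hx : IsGood x) :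
    SpreadingPre x hx →L[ℝ] SpreadingPre x hx :=
  LinearMap.mkContinuous (Finsupp.lmapDomain ℝ ℝ Nat.succ : (ℕ →₀ ℝ) →ₗ[ℝ] (ℕ →₀ ℝ)) 1
    fun a => ((spreadNorm_mapDomain_succ hx a).trans (one_mul _).symm).le

theorem isometry_spreadShift (x : ℕ → X) (hx : IsGood x) : Isometry (spreadShift x hx) :=
  AddMonoidHomClass.isometry_of_norm _ fun a => spreadNorm_mapDomain_succ hx a

/-- The finitely supported probability vectors. -/
def finsuppSimplex : Set (ℕ →₀ ℝ) := {a | (∀ i, 0 ≤ a i) ∧ (a.sum fun _ c => c) = 1}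

theorem convex_finsuppSimplex : Convex ℝ finsuppSimplex := by
  rintro a ⟨ha, ha1⟩ b ⟨hb, hb1⟩ s t hs ht hst
  refine ⟨fun i => ?_, ?_⟩
  · simpa using add_nonneg (mul_nonneg hs (ha i)) (mul_nonneg ht (hb i))
  · rw [Finsupp.sum_add_index' (by simp) (by simp), Finsupp.sum_smul_index (by simp),
      Finsupp.sum_smul_index (by simp), ← Finsupp.mul_sum, ← Finsupp.mul_sum, ha1, hb1]
    simpa using hst

theorem mapDomain_succ_mem_finsuppSimplex {a : ℕ →₀ ℝ} (ha : a ∈ finsuppSimplex) :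
    a.mapDomain Nat.succ ∈ finsuppSimplex := by
  refine ⟨fun i => ?_, ?_⟩
  · cases i with
    | zero => exact (Finsupp.mapDomain_of_notMem_range a 0 (by simp)).ge
    | succ i => exact (ha.1 i).trans (Finsupp.mapDomain_apply Nat.succ_injective a i).ge
  · rw [Finsupp.sum_mapDomain_index (by simp) (by simp)]
    exact ha.2

theorem norm_sum_smul_le_of_mem_finsuppSimplex {x : ℕ → X} {B : ℝ} (hB : ∀ n, ‖x n‖ ≤ B)
    {a : ℕ →₀ ℝ} (ha : a ∈ finsuppSimplex) : ‖a.sum fun i c => c • x i‖ ≤ B := by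
  calc ‖a.sum fun i c => c • x i‖ ≤ ∑ i ∈ a.support, ‖a i • x i‖ := norm_sum_le _ _
    _ ≤ ∑ i ∈ a.support, a i * B := Finset.sum_le_sum fun i _ => by
        rw [norm_smul, Real.norm_eq_abs, abs_of_nonneg (ha.1 i)]
        exact mul_le_mul_of_nonneg_left (hB i) (ha.1 i)
    _ = B := by
        have h : ∑ i ∈ a.support, a i = 1 := ha.2
        rw [← Finset.sum_mul, h, one_mul]

theorem spreadNorm_le_of_mem_finsuppSimplex {x : ℕ → X} (hx : IsGood x) {B : ℝ}
    (hB : ∀ n, ‖x n‖ ≤ B) {a : ℕ →₀ ℝ} (ha : a ∈ finsuppSimplex) : spreadNorm x a ≤ B := by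
  have := spreadFilter_neBot
  exact le_of_tendsto' (tendsto_spreadNorm hx a) fun n =>
    norm_sum_smul_le_of_mem_finsuppSimplex (x := fun i => x (n i)) (fun i => hB _) ha

/-- In a spreading model with the fixed point property for affine isometries, some convex
combination of the basis is almost invariant under the powers of the shift. -/
theorem FPPAffineIsometries.exists_spreadShift_iterate_norm_lt {x : ℕ → X} {hx : IsGood x}
    (h : FPPAffineIsometries (SpreadingModel x hx)) {B : ℝ} (hB : ∀ n, ‖x n‖ ≤ B) {ε : ℝ}
    (hε : 0 < ε) :
    ∃ a : SpreadingPre x hx, (a : ℕ →₀ ℝ) ∈ finsuppSimplex ∧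
      ∀ k, ‖a - (spreadShift x hx)^[k] a‖ < ε := by
  let S : Set (SpreadingPre x hx) := finsuppSimplex
  let J : SpreadingPre x hx →L[ℝ] SpreadingModel x hx := UniformSpace.Completion.toComplL
  let T : SpreadingModel x hx →L[ℝ] SpreadingModel x hx := (spreadShift x hx).completion
  have hTJ : ∀ a : SpreadingPre x hx, T (J a) = J (spreadShift x hx a) := fun a =>
    UniformSpace.Completion.map_coe (spreadShift x hx).uniformContinuous a
  have hT : Isometry T := (isometry_spreadShift x hx).completion_map
  have hS1 : (Finsupp.single 0 1 : ℕ →₀ ℝ) ∈ S := by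
    refine ⟨fun i => ?_, by simp⟩
    rw [Finsupp.single_apply]
    split_ifs <;> norm_num
  have hSc : Convex ℝ S := convex_finsuppSimplex
  obtain ⟨z, hz, hTz⟩ := h (closure (J '' S)) (Set.Nonempty.closure ⟨_, _, hS1, rfl⟩)
    isClosed_closure (hSc.linear_image J.toLinearMap).closure
    (Bornology.IsBounded.closure (isBounded_iff_forall_norm_le.2 ⟨B, by
      rintro _ ⟨a, ha, rfl⟩
      exact (UniformSpace.Completion.norm_coe a).trans_le
        (spreadNorm_le_of_mem_finsuppSimplex hx hB ha)⟩)) T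
    (Set.MapsTo.closure (by
      rintro _ ⟨a, ha, rfl⟩
      exact ⟨_, mapDomain_succ_mem_finsuppSimplex ha, (hTJ a).symm⟩) T.continuous)
    (fun u _ v _ => hT.dist_eq u v) (fun u _ v _ s t _ _ _ => by simp)
  obtain ⟨_, ⟨a, ha, rfl⟩, hd⟩ := Metric.mem_closure_iff.1 hz (ε / 2) (by positivity)
  refine ⟨a, ha, fun k => ?_⟩
  -- `z` is fixed and `T` is isometric, so the whole orbit of `J a` stays at the same distance from
  -- `z`.
  have hk : dist z (J ((spreadShift x hx)^[k] a)) = dist z (J a) := by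
    induction k with
    | zero => rfl
    | succ k ih =>
      rw [Function.iterate_succ_apply', ← hTJ]
      conv_lhs => rw [← hTz]
      rw [hT.dist_eq, ih]
  rw [← dist_eq_norm, ← UniformSpace.Completion.dist_eq]
  have := dist_triangle_left (J a) (J ((spreadShift x hx)^[k] a)) z
  exact this.trans_lt (by rw [hk]; linarith)

theorem spreadShift_iterate_apply (x : ℕ → X) (hx : IsGood x) (k : ℕ) (a : SpreadingPre x hx) :
    (spreadShift x hx)^[k] a = Finsupp.mapDomain (· + k) (a : ℕ →₀ ℝ) := by
  induction k with
  | zero => exact Finsupp.mapDomain_id.symm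
  | succ k ih =>
    rw [Function.iterate_succ_apply', ih]
    exact (Finsupp.mapDomain_comp (f := (· + k)) (g := Nat.succ)).symm

/-- Shifting `a` by a `k` beyond its support separates `a` from its translate, so the two blocks can
be placed in `x` with any gap between them. Two windows are then compared through a common later
one. -/
theorem exists_forall_norm_sum_sub_lt {x : ℕ → X} {hx : IsGood x}
    (h : FPPAffineIsometries (SpreadingModel x hx)) {B : ℝ} (hB : ∀ n, ‖x n‖ ≤ B) {ε : ℝ}
    (hε : 0 < ε) :
    ∃ a ∈ finsuppSimplex, ∃ N, ∀ j ≥ N,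
      ‖(a.sum fun i c => c • x (j + i)) - a.sum fun i c => c • x (N + i)‖ < ε := by
  obtain ⟨a, ha, hk⟩ := h.exists_spreadShift_iterate_norm_lt hB (half_pos hε)
  simp only [spreadShift_iterate_apply] at hk
  change ℕ →₀ ℝ at a
  obtain ⟨k, hak⟩ : ∃ k, a.support ⊆ Finset.range k := a.support.exists_nat_subset_range
  have hlt : spreadNorm x (a - Finsupp.mapDomain (· + k) a) < ε / 2 := hk k
  obtain ⟨t, ht, hsub⟩ := mem_comap.1
    ((tendsto_spreadNorm hx _).eventually (gt_mem_nhds hlt))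
  obtain ⟨N, hN⟩ := mem_atTop_sets.1 ht
  have hN' : ∀ n : ℕ ↪o ℕ, N ≤ n 0 →
      ‖(a.sum fun i c => c • x (n i)) - a.sum fun i c => c • x (n (i + k))‖ < ε / 2 := by
    intro n hn
    have h1 := hsub (show n ∈ _ ⁻¹' _ from hN _ hn)
    rw [Set.mem_ofPred_eq, Finsupp.sum_sub_index (by intros; rw [sub_smul]),
      Finsupp.sum_mapDomain_index (by simp) (by intros; rw [add_smul])] at h1
    exact h1
  have hJ : ∀ j J, N ≤ j → j ≤ J →
      ‖(a.sum fun i c => c • x (j + i)) - a.sum fun i c => c • x (J + (i + k))‖ < ε / 2 := by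
    intro j J hj hJ
    -- The first `k` indices start at `j`; the remaining ones jump ahead by `J - j`.
    have h1 := hN' (OrderEmbedding.ofStrictMono (fun i => if i < k then j + i else J + i)
      (strictMono_nat_of_lt_succ fun i => by split_ifs <;> omega))
      (by simp only [OrderEmbedding.coe_ofStrictMono]; split_ifs <;> omega)
    simp only [OrderEmbedding.coe_ofStrictMono] at h1
    have h2 : (a.sum fun i c => c • x (if i < k then j + i else J + i)) =
        a.sum fun i c => c • x (j + i) :=
      Finsupp.sum_congr fun i hi => by rw [if_pos (Finset.mem_range.1 (hak hi))]
    have h3 : (a.sum fun i c => c • x (if i + k < k then j + (i + k) else J + (i + k))) =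
        a.sum fun i c => c • x (J + (i + k)) :=
      Finsupp.sum_congr fun i hi => by rw [if_neg (by omega)]
    rwa [h2, h3] at h1
  refine ⟨a, ha, N, fun j hj => ?_⟩
  -- The windows at `j` and at `N` are both compared with the one at `j + k`.
  have h1 := hJ j j hj le_rfl
  have h2 := hJ N j le_rfl hj
  rw [norm_sub_rev] at h2
  have := norm_sub_le_norm_sub_add_norm_sub (a.sum fun i c => c • x (j + i))
    (a.sum fun i c => c • x (j + (i + k))) (a.sum fun i c => c • x (N + i))
  linarith

/-! ### Convergence of the means. -/

/-- The sum telescopes to two blocks of `p` terms, of total norm at most `2 * p * B`. -/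
theorem tendsto_cesaro_shift_sub {x : ℕ → X} {B : ℝ} (hB : ∀ n, ‖x n‖ ≤ B) (p : ℕ) :
    Tendsto (fun m : ℕ => (m : ℝ)⁻¹ • ∑ j ∈ Finset.range m, (x (p + j) - x j)) atTop (𝓝 0) := by
  have hlim : Tendsto (fun m : ℕ => (m : ℝ)⁻¹ * (2 * p * B)) atTop (𝓝 0) := by
    simpa using (tendsto_inv_atTop_nhds_zero_nat (𝕜 := ℝ)).mul_const (2 * p * B)
  refine squeeze_zero_norm (fun m => ?_) hlim
  have hs : ∀ q, ‖∑ j ∈ Finset.range p, x (q + j)‖ ≤ p * B := fun q => by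
    simpa using norm_sum_le_of_le (Finset.range p) (fun j _ => hB (q + j))
  have heq : ∑ j ∈ Finset.range m, (x (p + j) - x j) =
      ∑ j ∈ Finset.range p, x (m + j) - ∑ j ∈ Finset.range p, x (0 + j) := by
    have h1 := Finset.sum_range_add x m p
    have h2 := Finset.sum_range_add x p m
    rw [add_comm p m, h1] at h2
    rw [Finset.sum_sub_distrib, sub_eq_sub_iff_add_eq_add]
    simp only [zero_add]
    rw [add_comm (∑ j ∈ Finset.range m, x (p + j)), ← h2, add_comm]
  rw [norm_smul, norm_inv, RCLike.norm_natCast, heq]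
  gcongr
  have := norm_sub_le (∑ j ∈ Finset.range p, x (m + j)) (∑ j ∈ Finset.range p, x (0 + j))
  have := hs m
  have := hs 0
  linarith

/-- If the spreading model built on a bounded good sequence has the fixed point property for affine
isometries, then the arithmetic means of the sequence converge. -/
theorem exists_tendsto_cesaro [CompleteSpace X] {x : ℕ → X} {hx : IsGood x}
    (h : FPPAffineIsometries (SpreadingModel x hx)) {B : ℝ} (hB : ∀ n, ‖x n‖ ≤ B) :
    ∃ l, Tendsto (fun n : ℕ => (n : ℝ)⁻¹ • ∑ k ∈ Finset.range n, x k) atTop (𝓝 l) := by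
  refine cauchySeq_tendsto_of_complete (Metric.cauchySeq_iff'.2 fun ε hε => ?_)
  obtain ⟨a, ha, N, hN⟩ := exists_forall_norm_sum_sub_lt h hB (show 0 < ε / 4 by positivity)
  set w : ℕ → X := fun j => a.sum fun i c => c • x (j + i) with hw
  have hsum : ∑ i ∈ a.support, a i = 1 := ha.2
  -- Since the weights `a i` sum to 1, this is the mean of `w (N + ·)` minus the mean of `x`.
  have h1 : Tendsto (fun m : ℕ => ∑ i ∈ a.support, a i • ((m : ℝ)⁻¹ •
      ∑ j ∈ Finset.range m, (x (N + i + j) - x j))) atTop (𝓝 0) := by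
    simpa using tendsto_finsetSum a.support fun i _ =>
      (tendsto_cesaro_shift_sub hB (N + i)).const_smul (a i)
  have h2 : ∀ m : ℕ, ∑ i ∈ a.support, a i • ((m : ℝ)⁻¹ •
      ∑ j ∈ Finset.range m, (x (N + i + j) - x j)) =
      (m : ℝ)⁻¹ • ∑ j ∈ Finset.range m, w (N + j) - (m : ℝ)⁻¹ • ∑ j ∈ Finset.range m, x j := by
    intro m
    have e1 : ∑ i ∈ a.support, a i • ((m : ℝ)⁻¹ • ∑ j ∈ Finset.range m, x (N + i + j)) =
        (m : ℝ)⁻¹ • ∑ j ∈ Finset.range m, w (N + j) := by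
      simp only [hw, Finsupp.sum]
      rw [Finset.sum_comm, Finset.smul_sum]
      refine Finset.sum_congr rfl fun i _ => ?_
      rw [smul_comm, Finset.smul_sum]
      exact congrArg _ (Finset.sum_congr rfl fun j _ => by rw [add_right_comm])
    have e2 : ∑ i ∈ a.support, a i • ((m : ℝ)⁻¹ • ∑ j ∈ Finset.range m, x j) =
        (m : ℝ)⁻¹ • ∑ j ∈ Finset.range m, x j := by
      rw [← Finset.sum_smul, hsum, one_smul]
    simp only [Finset.sum_sub_distrib, smul_sub]
    rw [e1, e2]
  have h3 : ∀ m : ℕ, 1 ≤ m → ‖(m : ℝ)⁻¹ • ∑ j ∈ Finset.range m, w (N + j) - w N‖ ≤ ε / 4 := by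
    intro m hm
    have hm0 : (0 : ℝ) < m := by exact_mod_cast hm
    have : (m : ℝ)⁻¹ • ∑ j ∈ Finset.range m, w (N + j) - w N =
        (m : ℝ)⁻¹ • ∑ j ∈ Finset.range m, (w (N + j) - w N) := by
      rw [Finset.sum_sub_distrib, smul_sub, Finset.sum_const, Finset.card_range,
        ← Nat.cast_smul_eq_nsmul ℝ, inv_smul_smul₀ hm0.ne']
    rw [this, norm_smul, norm_inv, RCLike.norm_natCast, inv_mul_le_iff₀ hm0]
    simpa using norm_sum_le_of_le (Finset.range m)
      fun j _ => (hN (N + j) (Nat.le_add_right _ _)).le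
  simp only [h2] at h1
  obtain ⟨M, hM⟩ := eventually_atTop.1
    ((Metric.tendsto_nhds.1 h1 (ε / 4) (by positivity)).and (eventually_ge_atTop 1))
  -- The centre `w N` depends on `ε`, so only the Cauchy property results.
  have h4 : ∀ m ≥ M, dist ((m : ℝ)⁻¹ • ∑ j ∈ Finset.range m, x j) (w N) < ε / 2 := by
    intro m hm
    obtain ⟨h5, h6⟩ := hM m hm
    have h7 := h3 m h6
    rw [dist_zero_right, norm_sub_rev] at h5
    rw [dist_eq_norm]
    have := norm_sub_le_norm_sub_add_norm_sub ((m : ℝ)⁻¹ • ∑ j ∈ Finset.range m, x j)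
      ((m : ℝ)⁻¹ • ∑ j ∈ Finset.range m, w (N + j)) (w N)
    linarith
  exact ⟨M, fun m hm => (dist_triangle_right _ _ (w N)).trans_lt
    (by linarith [h4 m hm, h4 M le_rfl])⟩

end

theorem mainTheorem5 {X : Type*} [NormedAddCommGroup X] [NormedSpace ℝ X] [CompleteSpace X]
    (hM : ∀ (x : ℕ → X) (hx : IsGood x), (¬ ∃ l : X, Tendsto x atTop (𝓝 l)) →
      FPPAffineIsometries (SpreadingModel x hx)) :
    BanachSaksProperty X ∧ IsReflexiveSpace X := by
  have hBS : BanachSaksProperty X := by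
    intro x hbdd
    obtain ⟨B, hB⟩ := isBounded_iff_forall_norm_le.1 hbdd
    have hB' : ∀ n, ‖x n‖ ≤ B := fun n => hB _ ⟨n, rfl⟩
    obtain ⟨φ, hφ, hgood⟩ := exists_strictMono_isGood hB'
    refine ⟨φ, hφ, ?_⟩
    -- The hypothesis covers only non-convergent good sequences.
    by_cases hconv : ∃ l : X, Tendsto (x ∘ φ) atTop (𝓝 l)
    · obtain ⟨l, hl⟩ := hconv
      exact ⟨l, hl.cesaro_smul⟩
    · exact exists_tendsto_cesaro (hM _ hgood hconv) fun n => hB' _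
  exact ⟨hBS, hBS.isReflexiveSpace⟩
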